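/- Let $n,k\ge 2$, let $A$ be an alphabet with $k$ letters, and let $A^n$ be the set of all $k^n$ words of length $n$ over $A$. A universal word (u-word) for a set $S\subseteq A^n$ with $\ell$ words is a (non-circular) word $u_0u_1\cdots u_{\ell+n-2}$ over $A$ of length $\ell+n-1$ that contains each word from $S$ exactly once as a contiguous subword $u_iu_{i+1}\cdots u_{i+n-1}$ with $0\le i\le \ell-1$. For $s<k^n$, let $P_w(n,k,s)$ be the probability that $A^n\setminus R$ has a u-word, where $R$ is a uniformly random set of $s$ distinct words of $A^n$. Then $P_w(2,2,2)=\frac56$, and for all $n\ge 3$, \[P_w(n,2,2)=\frac{2^n-3}{(2^n-1)\,2^{n-3}}.\] Moreover, for all $k\ge 3$ and $n\ge 2$, \[P_w(n,k,2)=\frac{2(2k^n-3k+1)}{k^{n-1}(k^n-1)}.\] -/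

import Mathlib

/-- The contiguous subword `u_i u_{i+1} ⋯ u_{i+n-1}` of length `n` (for `0 ≤ i ≤ l - 1`) of a linear
word `u = u_0 u_1 ⋯ u_{l+n-2}` of length `l + n - 1`. Words of length `n` over the alphabet `A`
are functions `Fin n → A`. -/
def subwordAt {A : Type*} {l n : ℕ} (u : Fin (l + n - 1) → A) (i : Fin l) : Fin n → A :=
  fun j => u ⟨i.val + j.val, by have hi := i.isLt; have hj := j.isLt; omega⟩

/-- `u` is a universal word (u-word) for the set `S` of words of length `n`: it has length
`|S| + n - 1`, hence exactly `|S|` contiguous subwords of length `n` (counted by position), and each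
word of `S` occurs exactly once among them. -/
def IsUWord {A : Type*} {n : ℕ} (S : Finset (Fin n → A)) (u : Fin (S.card + n - 1) → A) : Prop :=
  ∀ w ∈ S, ∃! i : Fin S.card, subwordAt u i = w

/-- The set `S` of words of length `n` has a universal word. -/
def HasUWord {A : Type*} {n : ℕ} (S : Finset (Fin n → A)) : Prop :=
  ∃ u : Fin (S.card + n - 1) → A, IsUWord S u

instance {A : Type*} [DecidableEq A] {n : ℕ} (S : Finset (Fin n → A))
    (u : Fin (S.card + n - 1) → A) : Decidable (IsUWord S u) :=
  inferInstanceAs (Decidable (∀ w ∈ S, ∃ i : Fin S.card,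
    subwordAt u i = w ∧ ∀ j : Fin S.card, subwordAt u j = w → j = i))

instance {A : Type*} [Fintype A] [DecidableEq A] {n : ℕ} (S : Finset (Fin n → A)) :
    Decidable (HasUWord S) :=
  inferInstanceAs (Decidable (∃ u : Fin (S.card + n - 1) → A, IsUWord S u))

/-- `Pw n k s`: when `s` distinct words, forming a uniformly random `s`-element subset `R`, are
removed from the set `A^n` of all words of length `n` over the `k`-letter alphabet `A = Fin k`, this
is the probability that the set of the remaining words has a u-word. -/
def Pw (n k s : ℕ) : ℚ :=
  ((((Finset.univ : Finset (Fin n → Fin k)).powersetCard s).filter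
      (fun R => HasUWord (Finset.univ \ R))).card : ℚ) /
    (((Finset.univ : Finset (Fin n → Fin k)).powersetCard s).card : ℚ)

/-! Words of length n are the edges of the de Bruijn graph: `w` runs from `Fin.init w` to `Fin.tail
w`. A u-word for a set of words is a trail using each of these edges exactly once, so the question
is when the graph minus two edges `e`, `f` has an Eulerian trail.

The full graph is connected and balanced (equal in- and outdegree). If `e` or `f` is a loop,
deleting both leaves at most the two endpoints of one edge unbalanced, and a trail exists
(`hasUWord_of_loop`). If neither is a loop, the degrees allow a trail only when one edge starts
where the other ends (`HasUWord.overlap`). In that case connectedness decides: the remaining edges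
stay connected (`hasUWord_of_path`) unless the alphabet is binary and the middle vertex is constant,
when its loop is cut off (`not_hasUWord_of_isolated`). `hasUWord_iff` collects this.

For the count, ordered pairs containing a loop number 2k·k^n - k² - k. Pairs of non-loops forming a
path are counted by their middle vertex, and inclusion-exclusion removes the double count of
2-cycles, which are the pairs of alternating words. -/

/-! ### Euler's theorem for directed multigraphs, by merging cycles of a successor permutation. -/

section EulerianCircuit

open Equiv

variable {ι V : Type*} [Fintype ι]

/-- Composing with a transposition merges the two cycles of its entries. -/
theorem Equiv.Perm.sameCycle_mul_swap [DecidableEq ι] (σ : Perm ι) {x y z : ι} (hy : ¬ σ.SameCycle x y)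
    (hz : σ.SameCycle x z) : (σ * swap x y).SameCycle y z := by
  obtain ⟨j, hj, -, rfl⟩ := hz.exists_pow_eq''
  clear hz
  induction j, hj using Nat.le_induction with
  | base => exact ⟨1, by simp⟩
  | succ j hj ih =>
    -- On returning to `x` the next point is again `σ x`, the image of `y` under the new
    -- permutation. Away from `x` and `y` both permutations agree.
    by_cases h : (σ ^ j) x = x
    · refine ⟨1, ?_⟩
      simp [pow_succ', h]
    · have h' : (σ ^ j) x ≠ y := fun h' => hy ⟨j, by simpa using h'⟩
      refine ih.trans ⟨1, ?_⟩
      simp [pow_succ', swap_apply_of_ne_of_ne h h']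

/-- A finite directed multigraph with edges `ι`, sources `s` and targets `t`, in which the edges
can be permuted so that each is followed by a composable one, and which is connected, has an
Eulerian circuit. -/
theorem exists_perm_sameCycle (s t : ι → V) (σ₀ : Perm ι) (h₀ : ∀ x, t x = s (σ₀ x))
    (hconn : ∀ P : ι → Prop, (∀ x y, t x = s y → (P x ↔ P y)) → ∀ x y, P x → P y) :
    ∃ σ : Perm ι, (∀ x, t x = s (σ x)) ∧ ∀ x y, σ.SameCycle x y := by
  classical
  rcases isEmpty_or_nonempty ι with hι | ⟨⟨e⟩⟩
  · exact ⟨σ₀, h₀, fun x => hι.elim x⟩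
  -- Take a composable successor permutation whose cycle through `e` is largest. If it missed an
  -- edge `y` with the same target as an edge `x` on it, exchanging the successors of `x` and `y`
  -- would enlarge it.
  obtain ⟨σ, hσ, hmax⟩ := (Finset.univ.filter fun σ : Perm ι => ∀ x, t x = s (σ x)).exists_max_image
    (fun σ => (Finset.univ.filter fun y => σ.SameCycle e y).card) ⟨σ₀, by simpa using h₀⟩
  simp only [Finset.mem_filter, Finset.mem_univ, true_and] at hσ hmax
  refine ⟨σ, hσ, ?_⟩
  have key : ∀ x y, t x = t y → σ.SameCycle e x → σ.SameCycle e y := by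
    intro x y hxy hx
    by_contra hy
    have hxy' : ¬ σ.SameCycle x y := fun h => hy (hx.trans h)
    have hvalid : ∀ w, t w = s ((σ * swap x y) w) := by
      intro w
      rw [Perm.mul_apply, ← hσ]
      by_cases hwx : w = x
      · simp [hwx, hxy]
      by_cases hwy : w = y
      · simp [hwy, hxy]
      rw [swap_apply_of_ne_of_ne hwx hwy]
    refine absurd (hmax _ hvalid) (not_le.2 (Finset.card_lt_card ?_))
    have hye := Perm.sameCycle_mul_swap σ hxy' hx.symm
    refine Finset.ssubset_iff_of_subset ?_ |>.2 ⟨y, by simpa using hye.symm, by simpa using hy⟩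
    intro z hz
    simp only [Finset.mem_filter, Finset.mem_univ, true_and] at hz ⊢
    exact hye.symm.trans (Perm.sameCycle_mul_swap σ hxy' (hx.symm.trans hz))
  have hall : ∀ y, σ.SameCycle e y := by
    intro y
    refine hconn (fun y => σ.SameCycle e y) ?_ e y (Perm.SameCycle.refl _ _)
    intro x y hxy
    have h1 : t x = t (σ.symm y) := by rw [hxy, hσ]; simp
    have h2 : σ.SameCycle e (σ.symm y) ↔ σ.SameCycle e y := Perm.sameCycle_symm_apply_right
    rw [← h2]
    exact ⟨key _ _ h1, key _ _ h1.symm⟩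
  exact fun x y => (hall x).symm.trans (hall y)

/-- The powers of a transitive permutation below the number of points enumerate the points. -/
theorem Equiv.Perm.injective_pow_apply {σ : Perm ι} (hσ : ∀ x y, σ.SameCycle x y) (x : ι) :
    Function.Injective fun i : Fin (Fintype.card ι) => (σ ^ i.val) x := by
  refine ((Fintype.bijective_iff_surjective_and_card _).2 ⟨?_, by simp⟩).1
  intro y
  have hσ' : σ.IsCycleOn (Finset.univ : Finset ι) :=
    ⟨by simp, fun a _ b _ => hσ a b⟩
  obtain ⟨i, hi, h⟩ := hσ'.exists_pow_eq (Finset.mem_univ x) (Finset.mem_univ y)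
  exact ⟨⟨i, hi⟩, h⟩

end EulerianCircuit

/-! ### U-words as trails of overlapping words. -/

section Trail

variable {A : Type*} {m : ℕ}

/-- `w 0, …, w (l - 1)` are distinct words of `S` each of which overlaps the next one. -/
def IsTrail (S : Finset (Fin (m + 1) → A)) (w : ℕ → Fin (m + 1) → A) : Prop :=
  (∀ i < S.card, w i ∈ S) ∧ (∀ i < S.card, ∀ j < S.card, w i = w j → i = j) ∧
    ∀ i, i + 1 < S.card → Fin.tail (w i) = Fin.init (w (i + 1))

theorem IsTrail.image_range [DecidableEq A] {S : Finset (Fin (m + 1) → A)}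
    {w : ℕ → Fin (m + 1) → A} (hw : IsTrail S w) : (Finset.range S.card).image w = S := by
  refine Finset.eq_of_subset_of_card_le ?_ ?_
  · intro x hx
    obtain ⟨i, hi, rfl⟩ := Finset.mem_image.1 hx
    exact hw.1 i (Finset.mem_range.1 hi)
  · rw [Finset.card_image_of_injOn, Finset.card_range]
    intro i hi j hj h
    exact hw.2.1 i (by simpa using hi) j (by simpa using hj) h

theorem hasUWord_of_isTrail {S : Finset (Fin (m + 1) → A)} (hS : S.Nonempty)
    {w : ℕ → Fin (m + 1) → A} (hw : IsTrail S w) : HasUWord S := by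
  classical
  obtain ⟨-, hinj, hov⟩ := id hw
  have hl : 0 < S.card := hS.card_pos
  -- Iterated overlap: a letter depends only on its absolute position, whichever word of the trail
  -- it is read from.
  have key : ∀ d i j (hj : j + d < m + 1), i + d < S.card →
      w i ⟨j + d, hj⟩ = w (i + d) ⟨j, by omega⟩ := by
    intro d
    induction d with
    | zero => intro i j hj _; rfl
    | succ d ih =>
      intro i j hj hi
      have h1 := congrFun (hov i (by omega)) ⟨j + d, by omega⟩
      have h2 := ih (i + 1) j (by omega) (by omega)
      have h3 : i + 1 + d = i + (d + 1) := by omega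
      rw [h3] at h2
      exact h1.trans h2
  -- Position `t` is read as the first letter of word `t`, and past the last word from the remaining
  -- letters of that word.
  refine ⟨fun t => w (min t.val (S.card - 1)) ⟨t.val - min t.val (S.card - 1), by omega⟩, ?_⟩
  have hsub : ∀ i : Fin S.card, subwordAt
      (fun t : Fin (S.card + (m + 1) - 1) =>
        w (min t.val (S.card - 1)) ⟨t.val - min t.val (S.card - 1), by omega⟩) i = w i := by
    intro i
    ext j
    have hi := i.isLt
    have hd := key (min (i.val + j.val) (S.card - 1) - i) i
      (i.val + j.val - min (i.val + j.val) (S.card - 1)) (by omega) (by omega)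
    have h1 : i.val + (min (i.val + j.val) (S.card - 1) - i.val) =
      min (i.val + j.val) (S.card - 1) := by omega
    have h2 : i.val + j.val - min (i.val + j.val) (S.card - 1) +
      (min (i.val + j.val) (S.card - 1) - i.val) = j.val := by omega
    simp only [h1, h2] at hd
    exact hd.symm
  intro v hv
  rw [← hw.image_range] at hv
  obtain ⟨i, hi, rfl⟩ := Finset.mem_image.1 hv
  have hi' := Finset.mem_range.1 hi
  refine ⟨⟨i, hi'⟩, hsub _, ?_⟩
  intro j hj
  rw [hsub] at hj
  exact Fin.ext (hinj _ j.isLt _ hi' hj)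

theorem HasUWord.exists_isTrail {S : Finset (Fin (m + 1) → A)} (hS : S.Nonempty)
    (h : HasUWord S) : ∃ w, IsTrail S w := by
  classical
  obtain ⟨u, hu⟩ := h
  have hl : 0 < S.card := hS.card_pos
  choose g hg hg' using hu
  have hginj : Function.Injective fun w : S => g w.1 w.2 := by
    intro x y hxy
    have := hg x.1 x.2
    simp only at hxy
    rw [hxy, hg] at this
    exact Subtype.ext this.symm
  -- There are as many windows as words of `S`, so the injective map from words to their positions
  -- is onto and every window lies in `S`.
  have hgbij := (Fintype.bijective_iff_injective_and_card _).2 ⟨hginj, by simp⟩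
  have hmem : ∀ i, subwordAt u i ∈ S := by
    intro i
    obtain ⟨w, rfl⟩ := hgbij.2 i
    simp only [hg]
    exact w.2
  refine ⟨fun i => if h : i < S.card then subwordAt u ⟨i, h⟩ else subwordAt u ⟨0, hl⟩, ?_, ?_, ?_⟩
  · intro i hi
    simp only [hi, dif_pos, hmem]
  · intro i hi j hj hij
    simp only [hi, hj, dif_pos] at hij
    have h1 := hg' _ (hmem ⟨i, hi⟩) _ rfl
    have h2 := hg' _ (hmem ⟨i, hi⟩) _ hij.symm
    simpa using h1.trans h2.symm
  · intro i hi
    have hi' : i < S.card := by omega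
    simp only [hi, hi', dif_pos]
    ext j
    simp only [Fin.tail, Fin.init, subwordAt]
    congr 2
    simp
    omega

end Trail

/-! ### The de Bruijn graph with two edges removed. -/

section DeBruijnGraph

open Equiv

variable {A : Type*} {m : ℕ}

/-- Cyclic rotation of words, `w₀w₁⋯w_m ↦ w₁⋯w_m w₀`. -/
def rotateWord (A : Type*) (m : ℕ) : Perm (Fin (m + 1) → A) :=
  (finRotate (m + 1)).symm.arrowCongr (Equiv.refl A)

theorem init_rotateWord (w : Fin (m + 1) → A) : Fin.init (rotateWord A m w) = Fin.tail w := by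
  ext j
  simp [rotateWord, Fin.init, Fin.tail, Equiv.arrowCongr]

/-- This is balance of the de Bruijn graph: rotation matches the edges into each vertex with the
edges out of it. -/
theorem sum_tail_eq_sum_init [Fintype A] (φ : (Fin m → A) → ℤ) :
    ∑ w : Fin (m + 1) → A, φ (Fin.tail w) = ∑ w : Fin (m + 1) → A, φ (Fin.init w) := by
  classical
  rw [← Equiv.sum_comp (rotateWord A m) fun w => φ (Fin.init w)]
  simp only [init_rotateWord]

theorem exists_init_eq_ne [Nontrivial A] (v : Fin m → A) (f : Fin (m + 1) → A) :
    ∃ y ≠ f, Fin.init y = v := by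
  obtain ⟨c, hc⟩ := exists_ne (f (Fin.last m))
  refine ⟨Fin.snoc v c, ?_, Fin.init_snoc _ _⟩
  rintro rfl
  simp at hc

theorem exists_tail_eq_ne [Nontrivial A] (v : Fin m → A) (f : Fin (m + 1) → A) :
    ∃ y ≠ f, Fin.tail y = v := by
  obtain ⟨c, hc⟩ := exists_ne (f 0)
  refine ⟨Fin.cons c v, ?_, Fin.tail_cons _ _⟩
  rintro rfl
  simp at hc

/-- The de Bruijn graph is connected. -/
theorem iff_of_overlap {P : (Fin (m + 1) → A) → Prop}
    (h : ∀ x y, Fin.tail x = Fin.init y → (P x ↔ P y)) (x y : Fin (m + 1) → A) : P x ↔ P y := by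
  -- The sequence `x y y y ⋯`: its window of length m + 1 slides from `x` to `y` through overlapping
  -- words.
  let c : ℕ → A := fun i => if hi : i < m + 1 then x ⟨i, hi⟩ else y ⟨(i - (m + 1)) % (m + 1),
    Nat.mod_lt _ (Nat.succ_pos m)⟩
  have key : ∀ i, P x ↔ P fun j => c (i + j) := by
    intro i
    induction i with
    | zero =>
      have : (fun j : Fin (m + 1) => c (0 + j)) = x := by
        ext j
        simp only [c, Nat.zero_add, dif_pos j.isLt]
      rw [this]
    | succ i ih =>
      refine ih.trans (h _ _ ?_)
      ext j
      simp only [Fin.tail, Fin.init, Fin.val_succ, Fin.val_castSucc]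
      congr 1
      omega
  have : (fun j : Fin (m + 1) => c (m + 1 + j)) = y := by
    ext j
    have : ¬ m + 1 + j.val < m + 1 := by omega
    simp only [c, dif_neg this]
    congr 1
    ext
    simp [Nat.mod_eq_of_lt j.isLt]
  rw [key (m + 1), this]

theorem init_eq_tail_iff (w : Fin (m + 1) → A) :
    Fin.init w = Fin.tail w ↔ ∃ c, w = fun _ => c := by
  constructor
  · intro h
    refine ⟨w 0, funext fun j => ?_⟩
    induction j using Fin.induction with
    | zero => rfl
    | succ j ih => exact (congrFun h j).symm.trans ih
  · rintro ⟨c, rfl⟩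
    rfl

variable [Fintype A] [DecidableEq A]

theorem card_univ_sdiff_pair {e f : Fin (m + 1) → A} (hef : e ≠ f) :
    (Finset.univ \ {e, f}).card + 2 = Fintype.card (Fin (m + 1) → A) := by
  rw [Finset.card_sdiff_of_subset (Finset.subset_univ _), Finset.card_pair hef, Finset.card_univ]
  have := Finset.card_le_univ {e, f}
  rw [Finset.card_pair hef] at this
  omega

/-- A circuit through all words, with `f` following `e`, overlapping everywhere except next to
`e` and `f`, yields a u-word. -/
theorem hasUWord_of_perm {e f : Fin (m + 1) → A} (hef : e ≠ f)
    (hne : (Finset.univ \ {e, f}).Nonempty) {σ : Perm (Fin (m + 1) → A)}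
    (hσ : ∀ x y, σ.SameCycle x y) (he : σ e = f)
    (hov : ∀ x, x ≠ e → x ≠ f → Fin.tail x = Fin.init (σ x)) :
    HasUWord (Finset.univ \ {e, f}) := by
  have hcard := card_univ_sdiff_pair hef
  have hinj := Perm.injective_pow_apply hσ f
  set l := (Finset.univ \ {e, f}).card
  have hinj' : ∀ i < l + 2, ∀ j < l + 2, (σ ^ i) f = (σ ^ j) f → i = j := by
    intro i hi j hj h
    have := @hinj ⟨i, hcard ▸ hi⟩ ⟨j, hcard ▸ hj⟩ h
    simpa using this
  have hmem : ∀ i < l, (σ ^ (i + 1)) f ≠ e ∧ (σ ^ (i + 1)) f ≠ f := by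
    intro i hi
    constructor
    · intro h
      have h2 : (σ ^ (i + 2)) f = (σ ^ 0) f := by
        rw [pow_succ', Perm.mul_apply, h, he]; rfl
      have := hinj' _ (by omega) _ (by omega) h2
      omega
    · intro h
      have := hinj' (i + 1) (by omega) 0 (by omega) h
      omega
  -- Starting at `f` (exponent 0), the circuit ends with `e` (exponent `l + 1`), since `σ e = f`;
  -- the exponents in between give the trail.
  refine hasUWord_of_isTrail (w := fun i => (σ ^ (i + 1)) f) hne ⟨?_, ?_, ?_⟩
  · intro i hi
    simpa using hmem i hi
  · intro i hi j hj h
    have := hinj' _ (by omega) _ (by omega) h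
    omega
  · intro i hi
    have := hmem i (by omega)
    simp only
    rw [hov _ this.1 this.2, ← Perm.mul_apply, ← pow_succ']

/-- Euler's criterion for the graph in which `f` is moved so that it can only follow `e`, and
leads to `d`. -/
theorem hasUWord_of_connected {e f : Fin (m + 1) → A} (hef : e ≠ f)
    (hne : (Finset.univ \ {e, f}).Nonempty) (d : Fin m → A) (σ₀ : Perm (Fin (m + 1) → A))
    (he : σ₀ e = f) (hf : d = Fin.init (σ₀ f))
    (h₀ : ∀ x, x ≠ e → x ≠ f → Fin.tail x = Fin.init (σ₀ x))
    (hconn : ∀ P : (Fin (m + 1) → A) → Prop, (P e ↔ P f) → (∀ y ≠ f, d = Fin.init y → (P f ↔ P y)) →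
      (∀ x y, x ≠ e → x ≠ f → y ≠ f → Fin.tail x = Fin.init y → (P x ↔ P y)) → ∀ x y, P x → P y) :
    HasUWord (Finset.univ \ {e, f}) := by
  -- The new vertex `none` has `e` as its only incoming and `f` as its only outgoing edge, which
  -- forces `σ e = f`. The path `e f` closes the desired trail into a circuit, and `d` is the vertex
  -- where the trail starts.
  let s : (Fin (m + 1) → A) → Option (Fin m → A) := fun x => if x = f then none else some (Fin.init x)
  let t : (Fin (m + 1) → A) → Option (Fin m → A) := fun x =>
    if x = e then none else if x = f then some d else some (Fin.tail x)
  have hσf : ∀ σ : Perm (Fin (m + 1) → A), σ e = f → ∀ x ≠ e, σ x ≠ f := by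
    rintro σ rfl x hx h
    exact hx (σ.injective h)
  obtain ⟨σ, hσ, hcyc⟩ := exists_perm_sameCycle s t σ₀ (by
      intro x
      by_cases hxe : x = e
      · simp [s, t, hxe, he]
      by_cases hxf : x = f
      · subst hxf
        simp [s, t, hxe, hσf _ he _ hxe, hf]
      · simp [s, t, hxe, hxf, hσf _ he _ hxe, h₀ _ hxe hxf]) (by
      intro P hP
      refine hconn P (hP _ _ ?_) (fun y hy hd => hP _ _ ?_) (fun x y hxe hxf hyf hxy => hP _ _ ?_)
      · simp [s, t]
      · simp [s, t, hef.symm, hy, hd]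
      · simp [s, t, hxe, hxf, hyf, hxy])
  have hσe : σ e = f := by
    have := hσ e
    by_contra h
    simp [s, t, h] at this
  refine hasUWord_of_perm hef hne hcyc hσe ?_
  intro x hxe hxf
  have := hσ x
  simpa [s, t, hxe, hxf, hσf _ hσe _ hxe] using this

/-- With the trail starting at `Fin.tail e`, the path `e f` is just `e` subdivided, and deleting a
loop from the de Bruijn graph does not disconnect it. -/
theorem hasUWord_of_loop [Nontrivial A] {e f : Fin (m + 1) → A} (hef : e ≠ f)
    (hne : (Finset.univ \ {e, f}).Nonempty) (hf : Fin.init f = Fin.tail f) :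
    HasUWord (Finset.univ \ {e, f}) := by
  have hrot : rotateWord A m f = f := by
    obtain ⟨c, rfl⟩ := (init_eq_tail_iff f).1 hf
    rfl
  refine hasUWord_of_connected hef hne (Fin.tail e) (rotateWord A m * swap e f) ?_ ?_ ?_ ?_
  · simpa using hrot
  · simp [init_rotateWord]
  · intro x hxe hxf
    simp [init_rotateWord, swap_apply_of_ne_of_ne hxe hxf]
  · intro P hPef hPf hP
    have hP' : ∀ x y, x ≠ f → y ≠ f → Fin.tail x = Fin.init y → (P x ↔ P y) := by
      intro x y hx hy h
      by_cases hxe : x = e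
      · subst hxe
        exact hPef.trans (hPf y hy h)
      · exact hP x y hxe hx hy h
    obtain ⟨g, hg, hgf⟩ := exists_init_eq_ne (Fin.init f) f
    -- The loop `f` is given the value of another edge `g` leaving its vertex, so that connectedness
    -- of the full graph applies.
    have hall := iff_of_overlap (P := fun x => if x = f then P g else P x) (by
      intro x y hxy
      by_cases hx : x = f
      · by_cases hy : y = f
        · simp [hx, hy]
        · subst hx
          obtain ⟨z, hz, hz'⟩ := exists_tail_eq_ne (Fin.init g) x
          simp only [if_true, hy, if_false]
          exact (hP' z g hz hg hz').symm.trans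
            (hP' z y hz hy (hz'.trans (hgf.trans (hf.trans hxy))))
      · by_cases hy : y = f
        · subst hy
          simp only [if_true, hx, if_false]
          exact hP' x g hx hg (hxy.trans hgf.symm)
        · simpa [hx, hy] using hP' x y hx hy hxy)
    have hPe : ∀ x, P x ↔ P e := by
      intro x
      by_cases hx : x = f
      · rw [hx, hPef]
      · simpa [hx, hef] using hall x e
    exact fun x y => ((hPe x).trans (hPe y).symm).1

/-- The path `e f` is split off from its middle vertex. Connectedness survives if `e` still
communicates with another edge `g` into that vertex. The detour is `e`, `e₂`, `e₃`, `g`, with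
consecutive edges sharing alternately a source and a target. -/
theorem hasUWord_of_path_of_detour [Nontrivial A] {e f : Fin (m + 1) → A}
    (hne : (Finset.univ \ {e, f}).Nonempty) (he : Fin.init e ≠ Fin.tail e)
    (hf : Fin.init f ≠ Fin.tail f) (hef : Fin.tail e = Fin.init f)
    {g e₂ e₃ : Fin (m + 1) → A} (hge : g ≠ e) (hg : Fin.tail g = Fin.tail e)
    (hgl : Fin.init g ≠ Fin.tail e) (h₂ : e₂ ≠ e) (h₂₁ : Fin.init e₂ = Fin.init e)
    (h₃ : e₃ ≠ e) (h₃₄ : Fin.init e₃ = Fin.init g)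
    (h₂₃ : Fin.tail e₂ = Fin.tail e₃) :
    HasUWord (Finset.univ \ {e, f}) := by
  have hne' : e ≠ f := by
    rintro rfl
    exact he hef.symm
  -- In the rotation, `e` and the predecessor of `f` exchange successors; both end at the start of
  -- `f`.
  refine hasUWord_of_connected hne' hne (Fin.tail f)
    ((swap (rotateWord A m e) f) * rotateWord A m) (by simp) ?_ ?_ ?_
  · rw [Perm.mul_apply, swap_apply_of_ne_of_ne, init_rotateWord]
    · exact fun h => hne' ((rotateWord A m).injective h).symm
    · intro h
      have := init_rotateWord f
      rw [h] at this
      exact hf this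
  · intro x hxe hxf
    rw [Perm.mul_apply, ← init_rotateWord]
    by_cases h : rotateWord A m x = f
    · rw [h, swap_apply_right, init_rotateWord, hef]
    · rw [swap_apply_of_ne_of_ne _ h]
      exact fun h => hxe ((rotateWord A m).injective h)
  · intro P hPef hPf hP
    have hP' : ∀ x y, x ≠ e → y ≠ f → Fin.tail x = Fin.init y → (P x ↔ P y) := by
      intro x y hx hy h
      by_cases hxf : x = f
      · subst hxf; exact hPf y hy h
      · exact hP x y hx hxf hy h
    have htail : ∀ x y, x ≠ e → y ≠ e → Fin.tail x = Fin.tail y → (P x ↔ P y) := by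
      intro x y hx hy h
      obtain ⟨z, hz, hz'⟩ := exists_init_eq_ne (Fin.tail x) f
      exact (hP' x z hx hz hz'.symm).trans (hP' y z hy hz (h.symm.trans hz'.symm)).symm
    have hinit : ∀ x y, x ≠ f → y ≠ f → Fin.init x = Fin.init y → (P x ↔ P y) := by
      intro x y hx hy h
      obtain ⟨z, hz, hz'⟩ := exists_tail_eq_ne (Fin.init x) e
      exact (hP' z x hz hx hz').symm.trans (hP' z y hz hy (hz'.trans h))
    have hPg : P e ↔ P g := by
      refine (hinit e e₂ hne' ?_ h₂₁.symm).trans ((htail e₂ e₃ h₂ h₃ h₂₃).trans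
        (hinit e₃ g ?_ ?_ h₃₄))
      · rintro rfl
        exact he (h₂₁.symm.trans hef.symm)
      · rintro rfl
        exact hgl (h₃₄.symm.trans hef.symm)
      · rintro rfl
        exact hgl hef.symm
    suffices ∀ x y, Fin.tail x = Fin.init y → (P x ↔ P y) from
      fun x y => (iff_of_overlap this x y).1
    intro x y hxy
    have h1 : ∀ x, Fin.tail x = Fin.tail e → (P x ↔ P e) := by
      intro x hx
      by_cases h : x = e
      · rw [h]
      · exact (htail x g h hge (hx.trans hg.symm)).trans hPg.symm
    by_cases hyf : y = f
    · subst hyf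
      rw [h1 x (hxy.trans hef.symm), hPef]
    · by_cases hxe : x = e
      · subst hxe
        rw [hPg]
        exact hP' g y hge hyf (hg.trans hxy)
      · exact hP' x y hxe hyf hxy

theorem hasUWord_of_path {m : ℕ} (hA : 2 ≤ Fintype.card A) {e f : Fin (m + 2) → A}
    (hne : (Finset.univ \ {e, f}).Nonempty) (he : Fin.init e ≠ Fin.tail e)
    (hf : Fin.init f ≠ Fin.tail f) (hef : Fin.tail e = Fin.init f)
    (h : 3 ≤ Fintype.card A ∨ ¬ ∃ c, Fin.tail e = fun _ => c) :
    HasUWord (Finset.univ \ {e, f}) := by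
  have : Nontrivial A := Fintype.one_lt_card_iff_nontrivial.1 hA
  -- A second edge into the middle vertex, obtained by changing the first letter of `e`, which must
  -- not be the loop there. A third letter avoids this; at a non-constant vertex there is no loop.
  obtain ⟨x, hx, hx'⟩ : ∃ x ≠ e 0, Fin.init (Fin.cons x (Fin.tail e) : Fin (m + 2) → A) ≠
      Fin.tail e := by
    rcases h with h | h
    · obtain ⟨x, hx⟩ : ∃ x, x ∉ ({e 0, e 1} : Finset A) := by
        by_contra! hx
        have := Finset.card_le_card fun x (_ : x ∈ Finset.univ) => hx x
        rw [Finset.card_univ] at this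
        exact absurd (h.trans (this.trans Finset.card_le_two)) (by norm_num)
      simp only [Finset.mem_insert, Finset.mem_singleton, not_or] at hx
      exact ⟨x, hx.1, fun h => hx.2 (congrFun h 0)⟩
    · obtain ⟨x, hx⟩ := exists_ne (e 0)
      refine ⟨x, hx, fun hx' => h ?_⟩
      obtain ⟨c, hc⟩ := (init_eq_tail_iff (Fin.cons x (Fin.tail e) : Fin (m + 2) → A)).1
        (by rw [hx', Fin.tail_cons])
      refine ⟨c, ?_⟩
      rw [← Fin.tail_cons (α := fun _ => A) x (Fin.tail e), hc]
      rfl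
  obtain ⟨y, hy⟩ := exists_ne (e (Fin.last _))
  -- Changing the last letters of `e` and `g` to the same `y` gives `e₂` and `e₃`, which then have a
  -- common target.
  refine hasUWord_of_path_of_detour hne he hf hef (g := Fin.cons x (Fin.tail e))
    (e₂ := Fin.snoc (Fin.init e) y) (e₃ := Fin.snoc (Fin.cons x (Fin.init (Fin.tail e))) y)
    ?_ (Fin.tail_cons _ _) hx' ?_ (Fin.init_snoc _ _) ?_ ?_ ?_
  · intro h
    exact hx (by simpa using congrFun h 0)
  · intro h
    exact hy (by simpa using congrFun h (Fin.last _))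
  · intro h
    exact hy (by simpa using congrFun h (Fin.last _))
  · ext j
    cases j using Fin.cases with
    | zero => rfl
    | succ j =>
      simp only [Fin.init, Fin.castSucc_succ, Fin.cons_succ]
      rw [← Fin.castSucc_succ, Fin.snoc_castSucc, Fin.cons_succ]
      rfl
  · ext j
    cases j using Fin.lastCases with
    | last => simp [Fin.tail]
    | cast j =>
      simp only [Fin.tail, Fin.succ_castSucc, Fin.snoc_castSucc, Fin.cons_succ]
      rfl

/-- Removing two words from the de Bruijn graph leaves a graph with a trail only if the in- and
outdegrees remain balanced, apart from the ends of the trail. -/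
theorem HasUWord.overlap {e f : Fin (m + 1) → A} (hef : e ≠ f)
    (hne : (Finset.univ \ {e, f}).Nonempty) (h : HasUWord (Finset.univ \ {e, f}))
    (he : Fin.init e ≠ Fin.tail e) (hf : Fin.init f ≠ Fin.tail f) :
    Fin.tail e = Fin.init f ∨ Fin.tail f = Fin.init e := by
  obtain ⟨w, hw⟩ := h.exists_isTrail hne
  obtain ⟨-, hinj, hov⟩ := id hw
  have hl := hne.card_pos
  have htel : ∀ (φ : (Fin m → A) → ℤ) (l : ℕ), l + 1 ≤ (Finset.univ \ {e, f}).card →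
      ∑ i ∈ Finset.range (l + 1), (φ (Fin.tail (w i)) - φ (Fin.init (w i))) =
        φ (Fin.tail (w l)) - φ (Fin.init (w 0)) := by
    intro φ l hl
    induction l with
    | zero => simp
    | succ l ih =>
      rw [Finset.sum_range_succ, ih (by omega), hov l (by omega)]
      ring
  obtain ⟨l, hl'⟩ : ∃ l, l + 1 = (Finset.univ \ {e, f}).card := ⟨_, Nat.sub_add_cancel hl⟩
  -- Telescoping along the trail, compared with the sum over all words, which vanishes by balance.
  -- As `φ` is arbitrary, the targets of `e`, `f` and the trail agree, with multiplicity, with their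
  -- sources.
  have key : ∀ φ : (Fin m → A) → ℤ, φ (Fin.tail e) + φ (Fin.tail f) + φ (Fin.tail (w l)) =
      φ (Fin.init e) + φ (Fin.init f) + φ (Fin.init (w 0)) := by
    intro φ
    have h1 := htel φ l hl'.le
    rw [hl', ← Finset.sum_image (g := w) (f := fun x => φ (Fin.tail x) - φ (Fin.init x)), hw.image_range] at h1
    · have h2 := Finset.sum_sdiff (Finset.subset_univ {e, f})
        (f := fun x => φ (Fin.tail x) - φ (Fin.init x))
      rw [h1, Finset.sum_pair hef, Finset.sum_sub_distrib, sum_tail_eq_sum_init] at h2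
      linarith
    · intro i hi j hj h
      exact hinj i (by simpa using hi) j (by simpa using hj) h
  by_contra! hcon
  have h1 := key fun v => if v = Fin.tail e then 1 else 0
  have h2 := key fun v => if v = Fin.tail f then 1 else 0
  simp only [if_true, he, hcon.1.symm, hcon.2.symm, hf, if_false] at h1 h2
  -- Without an overlap, both targets can only be matched by the start of the trail. They then
  -- coincide, and one start cannot account for two targets.
  have h3 : Fin.init (w 0) = Fin.tail e := by
    by_contra h
    simp only [h, if_false] at h1
    split_ifs at h1 <;> omega
  have h4 : Fin.init (w 0) = Fin.tail f := by
    by_contra h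
    simp only [h, if_false] at h2
    split_ifs at h2 <;> omega
  rw [← h3, ← h4] at h1
  simp only [if_true] at h1
  split_ifs at h1 <;> omega

omit [DecidableEq A] in
theorem eq_of_ne_of_card_eq_two (hA : Fintype.card A = 2) {a b c : A} (hb : b ≠ a) (hc : c ≠ a) :
    b = c := by
  classical
  by_contra h
  have := Finset.card_le_univ {a, b, c}
  rw [Finset.card_eq_three.2 ⟨a, b, c, hb.symm, hc.symm, h, rfl⟩] at this
  omega

omit [DecidableEq A] in
theorem eq_of_init_eq_of_card_eq_two (hA : Fintype.card A = 2) {x y z : Fin (m + 1) → A}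
    (hy : y ≠ x) (hz : z ≠ x) (hyx : Fin.init y = Fin.init x) (hzx : Fin.init z = Fin.init x) :
    y = z := by
  have ne : ∀ u, u ≠ x → Fin.init u = Fin.init x → u (Fin.last m) ≠ x (Fin.last m) := by
    intro u hu hux h
    rw [← Fin.snoc_init_self u, ← Fin.snoc_init_self x, hux, h] at hu
    exact hu rfl
  rw [← Fin.snoc_init_self y, ← Fin.snoc_init_self z, hyx, hzx,
    eq_of_ne_of_card_eq_two hA (ne y hy hyx) (ne z hz hzx)]

omit [DecidableEq A] in
theorem eq_of_tail_eq_of_card_eq_two (hA : Fintype.card A = 2) {x y z : Fin (m + 1) → A}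
    (hy : y ≠ x) (hz : z ≠ x) (hyx : Fin.tail y = Fin.tail x) (hzx : Fin.tail z = Fin.tail x) :
    y = z := by
  have ne : ∀ u, u ≠ x → Fin.tail u = Fin.tail x → u 0 ≠ x 0 := by
    intro u hu hux h
    rw [← Fin.cons_self_tail u, ← Fin.cons_self_tail x, hux, h] at hu
    exact hu rfl
  rw [← Fin.cons_self_tail y, ← Fin.cons_self_tail z, hyx, hzx,
    eq_of_ne_of_card_eq_two hA (ne y hy hyx) (ne z hz hzx)]

/-- In the binary graph a constant vertex has one incoming and one outgoing edge besides its loop.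
When these are `e` and `f`, the loop can have no neighbour in a trail, yet the loop at the other
letter must be on it too. -/
theorem not_hasUWord_of_isolated (hA : Fintype.card A = 2) {e f : Fin (m + 1) → A}
    (he : Fin.init e ≠ Fin.tail e) (hf : Fin.init f ≠ Fin.tail f)
    (hef : Fin.tail e = Fin.init f) {c : A} (hc : Fin.tail e = fun _ => c) :
    ¬ HasUWord (Finset.univ \ {e, f}) := by
  intro h
  have : Nontrivial A := Fintype.one_lt_card_iff_nontrivial.1 (by omega)
  have hS : ∀ a, (fun _ => a) ∈ (Finset.univ : Finset (Fin (m + 1) → A)) \ {e, f} := by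
    intro a
    simp only [Finset.mem_sdiff, Finset.mem_univ, true_and, Finset.mem_insert,
      Finset.mem_singleton, not_or]
    constructor <;> rintro rfl <;> [exact he rfl; exact hf rfl]
  obtain ⟨w, hw⟩ := h.exists_isTrail ⟨_, hS c⟩
  have hsurj : ∀ a, ∃ i < (Finset.univ \ {e, f}).card, w i = fun _ => a := by
    intro a
    have := hS a
    rw [← hw.image_range] at this
    simpa using this
  obtain ⟨d, hd⟩ := exists_ne c
  obtain ⟨i, hi, hic⟩ := hsurj c
  obtain ⟨j, hj, hjd⟩ := hsurj d
  have hmem : ∀ i < (Finset.univ \ {e, f}).card, w i ≠ e ∧ w i ≠ f := by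
    intro i hi
    simpa using hw.1 i hi
  have hij : i ≠ j := by
    rintro rfl
    exact hd (congrFun (hjd.symm.trans hic) 0)
  by_cases hlast : i + 1 < (Finset.univ \ {e, f}).card
  · have h1 : Fin.init (w (i + 1)) = Fin.init f := by
      rw [← hw.2.2 i hlast, hic, ← hef, hc]; rfl
    have h2 : Fin.init (w i) = Fin.init f := by
      rw [hic, ← hef, hc]; rfl
    have := hw.2.1 _ hlast _ hi (eq_of_init_eq_of_card_eq_two hA (hmem _ hlast).2 (hmem _ hi).2 h1 h2)
    omega
  -- The loop is last on the trail, and the other loop occupies a different position, so it has a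
  -- predecessor.
  · obtain ⟨i, rfl⟩ : ∃ i', i = i' + 1 := ⟨i - 1, by omega⟩
    have hi' : i < (Finset.univ \ {e, f}).card := by omega
    have h1 : Fin.tail (w i) = Fin.tail e := by
      rw [hw.2.2 i hi, hic, hc]; rfl
    have h2 : Fin.tail (w (i + 1)) = Fin.tail e := by
      rw [hic, hc]; rfl
    have := hw.2.1 _ hi' _ hi (eq_of_tail_eq_of_card_eq_two hA (hmem _ hi').1 (hmem _ hi).1 h1 h2)
    omega

/-- `f` can be traversed directly after `e`, and doing so leaves the other words connected. -/
def Link (e f : Fin (m + 1) → A) : Prop :=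
  Fin.tail e = Fin.init f ∧ (3 ≤ Fintype.card A ∨ ¬ ∃ c, Fin.tail e = fun _ => c)

theorem hasUWord_iff {m : ℕ} (hA : 2 ≤ Fintype.card A) {e f : Fin (m + 2) → A} (hef : e ≠ f) :
    HasUWord (Finset.univ \ {e, f}) ↔
      Fin.init e = Fin.tail e ∨ Fin.init f = Fin.tail f ∨ Link e f ∨ Link f e := by
  have : Nontrivial A := Fintype.one_lt_card_iff_nontrivial.1 hA
  have hne : (Finset.univ \ {e, f}).Nonempty := by
    rw [← Finset.card_pos]
    have h1 := card_univ_sdiff_pair hef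
    have h2 : 2 * 2 ≤ Fintype.card A * Fintype.card A := Nat.mul_le_mul hA hA
    have h3 : Fintype.card A * Fintype.card A ≤ Fintype.card A ^ (m + 1 + 1) := by
      rw [← sq]
      exact Nat.pow_le_pow_right (by omega) (by omega)
    rw [Fintype.card_fun, Fintype.card_fin] at h1
    omega
  have hcomm : ({f, e} : Finset (Fin (m + 2) → A)) = {e, f} := Finset.pair_comm _ _
  by_cases he : Fin.init e = Fin.tail e
  · have := hasUWord_of_loop hef.symm (by rwa [hcomm]) he
    rw [hcomm] at this
    simp only [this, he, true_or]
  by_cases hf : Fin.init f = Fin.tail f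
  · simp only [hasUWord_of_loop hef hne hf, hf, true_or, or_true]
  simp only [he, hf, false_or]
  constructor
  · intro h
    refine (h.overlap hef hne he hf).imp (fun h1 => ⟨h1, ?_⟩) (fun h1 => ⟨h1, ?_⟩)
    · by_contra! h2
      obtain ⟨c, hc⟩ := h2.2
      exact not_hasUWord_of_isolated (by omega) he hf h1 hc h
    · by_contra! h2
      obtain ⟨c, hc⟩ := h2.2
      exact not_hasUWord_of_isolated (by omega) hf he h1 hc (by rwa [hcomm])
  · rintro (h | h)
    · exact hasUWord_of_path hA hne he hf h.1 h.2
    · rw [← hcomm] at hne ⊢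
      exact hasUWord_of_path hA hne hf he h.1 h.2

end DeBruijnGraph

/-! ### Counting the pairs. -/

section Counting

/-- Linking is directed, so ordered pairs are counted; each two-element set gives two of them. -/
theorem Finset.card_offDiag_filter_pair {α : Type*} [Fintype α] [DecidableEq α]
    (Q : Finset α → Prop) [DecidablePred Q] :
    ((Finset.univ : Finset α).offDiag.filter fun p => Q {p.1, p.2}).card =
      2 * (((Finset.univ : Finset α).powersetCard 2).filter Q).card := by
  rw [Finset.card_eq_sum_card_fiberwise (f := fun p => ({p.1, p.2} : Finset α))
    (t := ((Finset.univ : Finset α).powersetCard 2).filter Q), Finset.sum_const_nat (m := 2),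
    mul_comm]
  · intro R hR
    simp only [Finset.mem_filter, Finset.mem_powersetCard, Finset.subset_univ, true_and] at hR
    obtain ⟨a, b, hab, rfl⟩ := Finset.card_eq_two.1 hR.1
    rw [← Finset.card_pair (a := (a, b)) (b := (b, a)) (by simp [hab])]
    congr 1
    ext ⟨x, y⟩
    have hpair : ({x, y} : Finset α) = {a, b} ↔ x = a ∧ y = b ∨ x = b ∧ y = a := by
      rw [← Finset.coe_inj]
      simpa using Set.pair_eq_pair_iff
    simp only [Finset.mem_filter, Finset.mem_offDiag, Finset.mem_univ, true_and, hpair,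
      Finset.mem_insert, Finset.mem_singleton, Prod.mk.injEq]
    constructor
    · exact fun h => h.2
    · rintro (⟨rfl, rfl⟩ | ⟨rfl, rfl⟩)
      · exact ⟨⟨hab, hR.2⟩, by simp⟩
      · exact ⟨⟨hab.symm, by rw [Finset.pair_comm]; exact hR.2⟩, by simp⟩
  · intro p hp
    simp only [Finset.coe_filter, Finset.mem_offDiag, Finset.mem_univ, true_and,
      Set.mem_ofPred_eq] at hp
    simp [Finset.card_pair hp.1, hp.2]

variable {A : Type*} [Fintype A] {m : ℕ}

open Classical in
theorem card_filter_const (A : Type*) [Fintype A] (m : ℕ) :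
    (Finset.univ.filter fun w : Fin (m + 1) → A => ∃ c, w = fun _ => c).card = Fintype.card A := by
  have : (Finset.univ.filter fun w : Fin (m + 1) → A => ∃ c, w = fun _ => c) =
      Finset.univ.image fun (c : A) (_ : Fin (m + 1)) => c := by
    ext w
    simp [eq_comm]
  rw [this, Finset.card_image_of_injective, Finset.card_univ]
  exact fun a b h => congrFun h 0

open Classical in
theorem card_filter_not_const (A : Type*) [Fintype A] (m : ℕ) :
    (Finset.univ.filter fun w : Fin (m + 1) → A => ¬ ∃ c, w = fun _ => c).card + Fintype.card A =
      Fintype.card A ^ (m + 1) := by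
  have := Finset.card_filter_add_card_filter_not (s := Finset.univ)
    fun w : Fin (m + 1) → A => ∃ c, w = fun _ => c
  rw [card_filter_const, Finset.card_univ, Fintype.card_fun, Fintype.card_fin] at this
  rw [← this, add_comm]

/-- Both words of the pair are not loops, and the second can follow the first. -/
def LinkedPair (p : (Fin (m + 1) → A) × (Fin (m + 1) → A)) : Prop :=
  (¬ ∃ c, p.1 = fun _ => c) ∧ (¬ ∃ c, p.2 = fun _ => c) ∧ Link p.1 p.2

omit [Fintype A] in
theorem cons_eq_const_iff {a c : A} {v : Fin m → A} :
    (Fin.cons a v : Fin (m + 1) → A) = (fun _ => c) ↔ a = c ∧ v = fun _ => c := by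
  constructor
  · intro h
    refine ⟨congrFun h 0, ?_⟩
    rw [← Fin.tail_cons (α := fun _ => A) a v, h]
    rfl
  · rintro ⟨rfl, rfl⟩
    ext j
    cases j using Fin.cases <;> rfl

omit [Fintype A] in
theorem snoc_eq_const_iff {a c : A} {v : Fin m → A} :
    (Fin.snoc v a : Fin (m + 1) → A) = (fun _ => c) ↔ a = c ∧ v = fun _ => c := by
  constructor
  · intro h
    refine ⟨by simpa using congrFun h (Fin.last _), ?_⟩
    rw [← Fin.init_snoc (α := fun _ => A) a v, h]
    rfl
  · rintro ⟨rfl, rfl⟩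
    ext j
    cases j using Fin.lastCases <;> simp

-- Sorted by middle vertex `v`, a linked pair is `(a v, v b)`. The letters `a` and `b` are
-- independent, each barred only from making its word a loop, hence the square.
open Classical in
theorem card_linkedPair_eq_sum :
    (Finset.univ.filter (LinkedPair (A := A) (m := m))).card =
      ∑ v : Fin m → A, if 3 ≤ Fintype.card A ∨ ¬ ∃ c, v = fun _ => c then
        (Finset.univ.filter fun a : A => v ≠ fun _ => a).card ^ 2 else 0 := by
  rw [Finset.card_eq_sum_card_fiberwise (f := fun p => Fin.tail p.1) (t := Finset.univ)
    (by simp)]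
  refine Finset.sum_congr rfl fun v _ => ?_
  split_ifs with hv
  · rw [sq, ← Finset.card_product]
    symm
    refine Finset.card_bij (fun q _ => (Fin.cons q.1 v, Fin.snoc v q.2)) ?_ ?_ ?_
    · rintro ⟨a, b⟩ hq
      simp only [Finset.mem_product, Finset.mem_filter, Finset.mem_univ, true_and] at hq
      simp only [Finset.mem_filter, Finset.mem_univ, true_and, LinkedPair, Link, cons_eq_const_iff,
        snoc_eq_const_iff, Fin.tail_cons, Fin.init_snoc, hv, and_true]
      simpa using hq
    · rintro ⟨a, b⟩ _ ⟨a', b'⟩ _ h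
      have h1 := congrFun (congrArg Prod.fst h) 0
      have h2 := congrFun (congrArg Prod.snd h) (Fin.last _)
      simp at h1 h2
      rw [h1, h2]
    · rintro ⟨e, f⟩ h
      simp only [Finset.mem_filter, Finset.mem_univ, true_and, LinkedPair, Link] at h
      obtain ⟨⟨he, hf, h1, h2⟩, rfl⟩ := h
      refine ⟨(e 0, f (Fin.last _)), ?_, ?_⟩
      · simp only [Finset.mem_product, Finset.mem_filter, Finset.mem_univ, true_and]
        constructor
        · intro h
          exact he ⟨e 0, by rw [← cons_eq_const_iff.2 ⟨rfl, h⟩, Fin.cons_self_tail]⟩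
        · intro h
          exact hf ⟨f (Fin.last _),
            by rw [← snoc_eq_const_iff.2 ⟨rfl, h1.symm.trans h⟩, Fin.snoc_init_self]⟩
      · simp only [Fin.cons_self_tail]
        rw [h1, Fin.snoc_init_self]
  · rw [Finset.card_eq_zero, Finset.filter_eq_empty_iff]
    rintro ⟨e, f⟩ h rfl
    simp only [Finset.mem_filter, Finset.mem_univ, true_and] at h
    exact hv h.2.2.2

open Classical in
theorem card_linkedPair_of_card_eq_two (hA : Fintype.card A = 2) :
    (Finset.univ.filter (LinkedPair (A := A) (m := m + 1))).card + 8 = 4 * 2 ^ (m + 1) := by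
  have h := card_filter_not_const A m
  rw [card_linkedPair_eq_sum, ← Finset.sum_filter]
  simp only [hA, show ¬ 3 ≤ 2 by norm_num, false_or]
  rw [Finset.sum_const_nat (m := 4)]
  · rw [hA] at h
    omega
  · intro v hv
    simp only [Finset.mem_filter, Finset.mem_univ, true_and, not_exists] at hv
    rw [Finset.filter_true_of_mem fun a _ => hv a, Finset.card_univ, hA]
    norm_num

open Classical in
theorem card_linkedPair_of_three_le (hA : 3 ≤ Fintype.card A) :
    ((Finset.univ.filter (LinkedPair (A := A) (m := m + 1))).card : ℤ) =
      ((Fintype.card A : ℤ) ^ (m + 1) - Fintype.card A) * (Fintype.card A : ℤ) ^ 2 +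
        Fintype.card A * ((Fintype.card A : ℤ) - 1) ^ 2 := by
  rw [card_linkedPair_eq_sum]
  simp only [hA, true_or, if_true]
  rw [← Finset.sum_filter_add_sum_filter_not _ fun v : Fin (m + 1) → A => ∃ c, v = fun _ => c,
    Finset.sum_const_nat (m := (Fintype.card A - 1) ^ 2),
    Finset.sum_const_nat (m := (Fintype.card A) ^ 2), card_filter_const]
  · have h := card_filter_not_const A m
    have h' : ((Finset.univ.filter fun w : Fin (m + 1) → A => ¬ ∃ c, w = fun _ => c).card : ℤ) =
        (Fintype.card A : ℤ) ^ (m + 1) - Fintype.card A := by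
      rw [eq_sub_iff_add_eq]
      exact_mod_cast h
    push_cast [Nat.cast_sub (show 1 ≤ Fintype.card A by omega)]
    rw [h']
    ring
  · intro v hv
    simp only [Finset.mem_filter, Finset.mem_univ, true_and, not_exists] at hv
    rw [Finset.filter_true_of_mem fun a _ => hv a, Finset.card_univ]
  · intro v hv
    simp only [Finset.mem_filter, Finset.mem_univ, true_and] at hv
    obtain ⟨c, rfl⟩ := hv
    have : (Finset.univ.filter fun a : A => (fun _ : Fin (m + 1) => c) ≠ fun _ => a) =
        Finset.univ.erase c := by
      ext a
      simp [funext_iff, eq_comm]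
    rw [this, Finset.card_erase_of_mem (Finset.mem_univ _), Finset.card_univ]

/-- The word `abab⋯`. -/
def alternatingWord (m : ℕ) (a b : A) : Fin (m + 1) → A := fun i => if Even i.val then a else b

-- Each letter of one word is the preceding letter of the other, so the two first letters determine
-- both words.
omit [Fintype A] in
theorem eq_alternatingWord {e f : Fin (m + 1) → A} (h₁ : Fin.tail e = Fin.init f)
    (h₂ : Fin.tail f = Fin.init e) :
    e = alternatingWord m (e 0) (f 0) ∧ f = alternatingWord m (f 0) (e 0) := by
  have : ∀ j, e j = alternatingWord m (e 0) (f 0) j ∧ f j = alternatingWord m (f 0) (e 0) j := by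
    intro j
    induction j using Fin.induction with
    | zero => simp [alternatingWord]
    | succ j ih =>
      have h1 : e j.succ = f j.castSucc := congrFun h₁ j
      have h2 : f j.succ = e j.castSucc := congrFun h₂ j
      rw [h1, h2, ih.1, ih.2]
      by_cases h : Even j.val <;> simp [alternatingWord, h, Nat.even_add_one]
  exact ⟨funext fun j => (this j).1, funext fun j => (this j).2⟩

omit [Fintype A] in
theorem tail_alternatingWord (a b : A) :
    Fin.tail (alternatingWord m a b) = Fin.init (alternatingWord m b a) := by
  ext j
  by_cases h : Even j.val <;> simp [Fin.tail, Fin.init, alternatingWord, h, Nat.even_add_one]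

omit [Fintype A] in
theorem alternatingWord_ne_const {a b : A} (hab : a ≠ b) :
    ¬ ∃ c, alternatingWord (m + 1) a b = fun _ => c := by
  rintro ⟨c, h⟩
  have h0 := congrFun h 0
  have h1 := congrFun h 1
  simp [alternatingWord] at h0 h1
  exact hab (h0.trans h1.symm)

-- 2-cycles correspond to ordered pairs of distinct letters. The hypothesis rules out binary words
-- of length 2, whose middle vertices are all constant, so that nothing is linked.
open Classical in
theorem card_linkedPair_and_swap (h : 3 ≤ Fintype.card A ∨ 1 ≤ m) :
    (Finset.univ.filter fun p => LinkedPair (A := A) (m := m + 1) p ∧ LinkedPair p.swap).card =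
      Fintype.card A * Fintype.card A - Fintype.card A := by
  rw [← Finset.card_univ, ← Finset.offDiag_card]
  symm
  have hlink : ∀ a b : A, a ≠ b →
      LinkedPair (alternatingWord (m + 1) a b, alternatingWord (m + 1) b a) := by
    intro a b hab
    refine ⟨alternatingWord_ne_const hab, alternatingWord_ne_const hab.symm,
      tail_alternatingWord _ _, h.imp_right fun hm => ?_⟩
    obtain ⟨m, rfl⟩ : ∃ m', m = m' + 1 := ⟨m - 1, by omega⟩
    rw [tail_alternatingWord]
    exact alternatingWord_ne_const (m := m) hab.symm
  refine Finset.card_bij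
    (fun q _ => (alternatingWord (m + 1) q.1 q.2, alternatingWord (m + 1) q.2 q.1)) ?_ ?_ ?_
  · rintro ⟨a, b⟩ hq
    simp only [Finset.mem_offDiag, Finset.mem_univ, true_and] at hq
    simp only [Finset.mem_filter, Finset.mem_univ, true_and]
    exact ⟨hlink a b hq, hlink b a hq.symm⟩
  · rintro ⟨a, b⟩ _ ⟨a', b'⟩ _ h
    have h1 := congrFun (congrArg Prod.fst h) 0
    have h2 := congrFun (congrArg Prod.snd h) 0
    simp [alternatingWord] at h1 h2
    rw [h1, h2]
  · rintro ⟨e, f⟩ h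
    simp only [Finset.mem_filter, Finset.mem_univ, true_and] at h
    obtain ⟨h1, h2⟩ := eq_alternatingWord h.1.2.2.1 h.2.2.2.1
    refine ⟨(e 0, f 0), ?_, ?_⟩
    · simp only [Finset.mem_offDiag, Finset.mem_univ, true_and]
      intro hef
      refine h.1.1 ⟨e 0, h1.trans ?_⟩
      simp only [← hef]
      exact funext fun _ => by simp [alternatingWord]
    · simp only [← h1, ← h2]

open Classical in
/-- Twice the number of pairs of words whose removal leaves a u-word. -/
theorem two_mul_card_hasUWord (hA : 2 ≤ Fintype.card A) :
    (2 * (((Finset.univ : Finset (Fin (m + 2) → A)).powersetCard 2).filter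
      (fun R => HasUWord (Finset.univ \ R))).card : ℤ) =
      2 * Fintype.card A * Fintype.card A ^ (m + 2) - Fintype.card A ^ 2 - Fintype.card A +
      (2 * (Finset.univ.filter (LinkedPair (A := A) (m := m + 1))).card -
        (Finset.univ.filter fun p => LinkedPair (A := A) (m := m + 1) p ∧ LinkedPair p.swap).card) := by
  set L : Finset (Fin (m + 2) → A) := Finset.univ.filter fun w => ¬ ∃ c, w = fun _ => c
  set G := Finset.univ.filter (LinkedPair (A := A) (m := m + 1))
  have hL : L.card + Fintype.card A = Fintype.card A ^ (m + 2) :=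
    card_filter_not_const A (m + 1)
  -- Disjoint cases: some word of the pair is a loop, or neither is and they are linked in at least
  -- one direction.
  have hsplit : (Finset.univ.offDiag.filter fun p : (Fin (m + 2) → A) × (Fin (m + 2) → A) =>
      HasUWord (Finset.univ \ {p.1, p.2})) =
      (Finset.univ.offDiag \ L.offDiag) ∪ (G ∪ G.image Prod.swap) := by
    ext ⟨e, f⟩
    have hG : (e, f) ∈ G.image Prod.swap ↔ LinkedPair (f, e) := by
      simp [G]
    have hne : LinkedPair (e, f) ∨ LinkedPair (f, e) → e ≠ f := by
      rintro (h | h) rfl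
      all_goals exact h.1 ((init_eq_tail_iff e).1 h.2.2.1.symm)
    simp only [Finset.mem_union, hG, Finset.mem_filter, Finset.mem_offDiag, Finset.mem_univ,
      true_and, Finset.mem_sdiff, G, L]
    by_cases hef : e = f
    · simp only [hef, ne_eq, not_true, false_and, false_or, false_iff]
      rw [hef] at hne
      exact fun h => hne h rfl
    · rw [hasUWord_iff hA hef, init_eq_tail_iff, init_eq_tail_iff]
      simp only [LinkedPair, hef, ne_eq, not_false_eq_true, true_and, and_true]
      tauto
  have hdisj : Disjoint (Finset.univ.offDiag \ L.offDiag) (G ∪ G.image Prod.swap) := by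
    rw [Finset.disjoint_left]
    rintro ⟨e, f⟩ h h'
    have hG : (e, f) ∈ G.image Prod.swap ↔ LinkedPair (f, e) := by
      simp [G]
    simp only [Finset.mem_union, hG, Finset.mem_filter, Finset.mem_offDiag, Finset.mem_univ,
      true_and, Finset.mem_sdiff, G, L] at h h'
    refine h.2 ?_
    rcases h' with h' | h'
    · exact ⟨h'.1, h'.2.1, h.1⟩
    · exact ⟨h'.2.1, h'.1, h.1⟩
  have hinter : G ∩ G.image Prod.swap = Finset.univ.filter fun p =>
      LinkedPair (A := A) (m := m + 1) p ∧ LinkedPair p.swap := by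
    ext ⟨e, f⟩
    simp [G]
  have hunion := Finset.card_union_add_card_inter G (G.image Prod.swap)
  rw [hinter, Finset.card_image_of_injective _ Prod.swap_injective] at hunion
  have hoff := Finset.card_sdiff_add_card_eq_card
    (Finset.offDiag_mono (Finset.subset_univ L))
  have hoffL : L.offDiag.card + L.card = L.card * L.card := by
    rw [Finset.offDiag_card, Nat.sub_add_cancel (Nat.le_mul_self _)]
  have hoffW : (Finset.univ : Finset (Fin (m + 2) → A)).offDiag.card +
      Fintype.card A ^ (m + 2) = Fintype.card A ^ (m + 2) * Fintype.card A ^ (m + 2) := by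
    rw [Finset.offDiag_card, Finset.card_univ, Fintype.card_fun, Fintype.card_fin,
      Nat.sub_add_cancel (Nat.le_mul_self _)]
  have hcount := Finset.card_offDiag_filter_pair fun R : Finset (Fin (m + 2) → A) =>
    HasUWord (Finset.univ \ R)
  rw [hsplit, Finset.card_union_of_disjoint hdisj] at hcount
  zify at hcount hoffL hoffW hoff hunion hL
  have hL' : (L.card : ℤ) = Fintype.card A ^ (m + 2) - Fintype.card A :=
    eq_sub_of_add_eq hL
  rw [hL'] at hoffL
  rw [← hcount]
  linear_combination hoff - hoffL + hoffW + hunion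

theorem Pw_two_eq {m k : ℕ} {N : ℤ} (h : (2 * (((Finset.univ : Finset (Fin (m + 2) →
      Fin k)).powersetCard 2).filter (fun R => HasUWord (Finset.univ \ R))).card : ℤ) = N) :
    Pw (m + 2) k 2 = N / ((k : ℚ) ^ (m + 2) * ((k : ℚ) ^ (m + 2) - 1)) := by
  have h' : (2 * (((Finset.univ : Finset (Fin (m + 2) → Fin k)).powersetCard 2).filter
      (fun R => HasUWord (Finset.univ \ R))).card : ℚ) = N := by
    exact_mod_cast h
  rw [Pw, ← h', Finset.card_powersetCard, Nat.cast_choose_two, Finset.card_univ, Fintype.card_fun,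
    Fintype.card_fin, Fintype.card_fin]
  push_cast
  rw [div_div_eq_mul_div, mul_comm]

theorem Pw_two_of_three_le (m : ℕ) {k : ℕ} (hk : 3 ≤ k) :
    Pw (m + 2) k 2 = 2 * (2 * (k : ℚ) ^ (m + 2) - 3 * (k : ℚ) + 1) /
      ((k : ℚ) ^ (m + 1) * ((k : ℚ) ^ (m + 2) - 1)) := by
  classical
  have hcard : 3 ≤ Fintype.card (Fin k) := by simpa using hk
  have h := two_mul_card_hasUWord (A := Fin k) (m := m) (by omega)
  rw [card_linkedPair_of_three_le hcard, card_linkedPair_and_swap (Or.inl hcard),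
    Nat.cast_sub (Nat.le_mul_self _), Fintype.card_fin] at h
  -- Here `congr!` only reconciles different decidability instances.
  rw [Pw_two_eq (Eq.trans (by congr!) h)]
  have hk0 : (k : ℚ) ≠ 0 := by
    have : 0 < k := by omega
    positivity
  have hne : (k : ℚ) ^ (m + 2) - 1 ≠ 0 :=
    sub_ne_zero.2 (one_lt_pow₀ (by exact_mod_cast (by omega : 1 < k)) (by omega)).ne'
  rw [div_eq_div_iff (mul_ne_zero (pow_ne_zero _ hk0) hne) (mul_ne_zero (pow_ne_zero _ hk0) hne)]
  push_cast
  ring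

end Counting

/-! ### The three probabilities. -/

theorem mainTheorem1 :
    Pw 2 2 2 = 5 / 6 ∧
    (∀ n : ℕ, 3 ≤ n → Pw n 2 2 = ((2 : ℚ) ^ n - 3) / (((2 : ℚ) ^ n - 1) * (2 : ℚ) ^ (n - 3))) ∧
    (∀ n k : ℕ, 2 ≤ n → 3 ≤ k →
      Pw n k 2 = 2 * (2 * (k : ℚ) ^ n - 3 * (k : ℚ) + 1) /
        ((k : ℚ) ^ (n - 1) * ((k : ℚ) ^ n - 1))) := by
  classical
  have htwo : ∀ m, _ := fun m => two_mul_card_hasUWord (A := Fin 2) (m := m) (by simp)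
  refine ⟨?_, ?_, ?_⟩
  · have h := htwo 0
    have hG := card_linkedPair_of_card_eq_two (A := Fin 2) (m := 0) (by simp)
    -- For length 2 the vertices are single letters, hence constant, so only pairs containing a loop
    -- survive: 10 of the 12 ordered pairs.
    have hG0 : (Finset.univ.filter (LinkedPair (A := Fin 2) (m := 0 + 1))).card = 0 := by omega
    rw [Finset.filter_and, Finset.card_eq_zero.1 hG0, Finset.empty_inter, Finset.card_empty,
      Fintype.card_fin] at h
    rw [Pw_two_eq (m := 0) (Eq.trans (by congr!) h)]
    norm_num
  · intro n hn
    obtain ⟨m, rfl⟩ : ∃ m, n = m + 3 := ⟨n - 3, by omega⟩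
    have h := htwo (m + 1)
    have hG := card_linkedPair_of_card_eq_two (A := Fin 2) (m := m + 1) (by simp)
    have hG' : ((Finset.univ.filter (LinkedPair (A := Fin 2) (m := m + 1 + 1))).card : ℤ) =
        4 * 2 ^ (m + 1 + 1) - 8 := by
      rw [eq_sub_iff_add_eq]
      exact_mod_cast hG
    rw [hG', card_linkedPair_and_swap (Or.inr (by omega)), Fintype.card_fin] at h
    rw [Pw_two_eq (m := m + 1) (Eq.trans (by congr!) h)]
    have hne : (2 : ℚ) ^ (m + 3) - 1 ≠ 0 :=
      sub_ne_zero.2 (one_lt_pow₀ (by norm_num) (by omega)).ne'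
    rw [Nat.add_sub_cancel, div_eq_div_iff]
    · push_cast
      ring
    · push_cast
      exact mul_ne_zero (by positivity) hne
    · exact mul_ne_zero hne (by positivity)
  · intro n k hn hk
    obtain ⟨m, rfl⟩ : ∃ m, n = m + 2 := ⟨n - 2, by omega⟩
    exact Pw_two_of_three_le m hk
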